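/- Let $q$ be a power of an odd prime and let $\mathbb F_{q^8}$ be the field with $q^8$ elements. Let $\psi_8\colon\mathbb F_{q^8}\to\mathbb F_{q^8}$ be the $\mathbb F_q$-linear map $$\psi_8(x)=\frac{(x+x^{q^4})^{q^3}}{2}+\frac{(x-x^{q^4})^{q}}{2}=\tfrac12\bigl(x^{q}+x^{q^{3}}-x^{q^{5}}+x^{q^{7}}\bigr),$$ and let $\psi_8^{(k)}$ be its $k$-fold composition with itself. For an $\mathbb F_q$-linear map $f\colon\mathbb F_{q^8}\to\mathbb F_{q^8}$ let $$L_f=\{\langle (x,f(x))\rangle_{\mathbb F_{q^8}} : x\in\mathbb F_{q^8},\ x\neq 0\}\subseteq \mathrm{PG}(1,q^8).$$ A set of points of $\mathrm{PG}(1,q^8)$ is said to be of LP-type if it is equivalent, under the action of $\mathrm{P\Gamma L}(2,q^8)$, to $L_g$ for some $g(x)=\delta x^{q^s}+x^{q^{8-s}}$ with $1\le s\le 7$, $\gcd(s,8)=1$, $\delta\in\mathbb F_{q^8}$ and $\mathrm N_{q^8/q}(\delta)=\delta^{(q^8-1)/(q-1)}\notin\{0,1\}$. Then, for $k=1$ and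 for $k=3$, the linear set $L_{\psi_8^{(k)}}$ is not of LP-type. -/

import Mathlib

open scoped LinearAlgebra.Projectivization

namespace ScatteredLinearSets

section

variable (F K : Type*) [Field F] [Finite F] [Field K] [Algebra F K]

/-- The `F`-linear map `x ↦ x ^ (q ^ i)` of `K`, where `q` is the order of the finite field `F`. -/
noncomputable def qPow (i : ℕ) : Module.End F K where
  toFun x := x ^ (Nat.card F ^ i)
  map_add' x y := by
    have := Fintype.ofFinite F
    have h := map_add (FiniteField.frobeniusAlgHom F K ^ i) x y
    simpa [AlgHom.coe_pow, FiniteField.coe_frobeniusAlgHom, pow_iterate,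
      Nat.card_eq_fintype_card] using h
  map_smul' c x := by
    have := Fintype.ofFinite F
    have h := map_smul (FiniteField.frobeniusAlgHom F K ^ i) c x
    simpa only [AlgHom.id_apply, RingHom.id_apply, AlgHom.coe_pow, FiniteField.coe_frobeniusAlgHom, pow_iterate,
      Nat.card_eq_fintype_card] using h

/-- `α(x) = (x + x ^ (q ^ t)) ^ (q ^ (t - 1)) / 2`, for `K` of degree `2 t ≥ 2` over `F`. -/
noncomputable def alpha (t : ℕ) : Module.End F K :=
  (2⁻¹ : K) • (qPow F K (t - 1) ∘ₗ (LinearMap.id + qPow F K t))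

/-- `β(x) = (x - x ^ (q ^ t)) ^ q / 2`, for `K` of degree `2 t` over `F`. -/
noncomputable def beta (t : ℕ) : Module.End F K :=
  (2⁻¹ : K) • (qPow F K 1 ∘ₗ (LinearMap.id - qPow F K t))

/-- `ψ = α + β`. Its `k`-fold composition is the power `psi F K t ^ k` in `Module.End F K`. -/
noncomputable def psi (t : ℕ) : Module.End F K :=
  alpha F K t + beta F K t

end

section

variable {F K : Type*} [Field F] [Field K] [Algebra F K]

/-- The linear set `L_U` of an `F`-subspace `U` of `K ^ 2`: the points of the projective line
over `K` that are spanned by the nonzero vectors of `U`. -/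
def linearSet (U : Submodule F (K × K)) : Set (ℙ K (K × K)) :=
  {P | ∃ (u : K × K) (hu : u ≠ 0), u ∈ U ∧ P = Projectivization.mk K u hu}

/-- `L_f = L_{U_f}`, where `U_f = {(x, f x)}` is the graph of `f`. -/
def linearSetOf (f : Module.End F K) : Set (ℙ K (K × K)) :=
  linearSet (LinearMap.graph f)

/-- Two sets of points of the projective line over `K` are equivalent under `PΓL(2, K)`, that is,
under the collineations induced by the bijective semilinear maps of `K ^ 2`, relative to an
arbitrary automorphism `σ` of the field `K`. -/
def PGammaLEquivalent (L₁ L₂ : Set (ℙ K (K × K))) : Prop :=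
  ∃ (σ : K ≃+* K) (A : (K × K) →ₛₗ[(σ : K →+* K)] (K × K)) (hA : Function.Bijective A),
    Projectivization.map A hA.injective '' L₁ = L₂

/-- A set of points of the projective line over `K` is of LP-type (relative to `F`) if it is
equivalent under `PΓL(2, K)` to the linear set of some `δ x ^ (q ^ s) + x ^ (q ^ (n - s))`, where
`n = [K : F] ≥ 4`, `1 ≤ s ≤ n - 1`, `gcd (s, n) = 1` and the norm of `δ` over `F` is neither `0`
nor `1`. -/
def IsLPType (F : Type*) [Field F] [Finite F] [Algebra F K] (L : Set (ℙ K (K × K))) : Prop :=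
  4 ≤ Module.finrank F K ∧
    ∃ (s : ℕ) (δ : K), 1 ≤ s ∧ s < Module.finrank F K ∧ s.gcd (Module.finrank F K) = 1 ∧
      Algebra.norm F δ ≠ 0 ∧ Algebra.norm F δ ≠ 1 ∧
      PGammaLEquivalent L
        (linearSetOf (δ • qPow F K s + qPow F K (Module.finrank F K - s)))

end

end ScatteredLinearSets

/-! Let σ be a generator of the Galois group and f = ∑ aⱼσʲ. An element w is a slope f(x)/x exactly
when the Dickson matrix of f - w·id is singular. Its determinant is a multilinear form in eight
slots, evaluated at the conjugates σⁱ(1, w). The 2⁸ monomials of the form become distinct powers of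
w, their exponents having base-q digits 0 and 1, so nothing is lost in restricting to conjugates.
The form is therefore determined, up to scale, by its zeros as soon as there are (qⁿ - 1)/(q - 1) of
them (`multilinearMap_eq_zero_of_many_zeros`).

The iterates in question are scattered (`autPsi_scattered`), so they have that many slopes
(`sum_pow_le_card_slopes`). An equivalence with the linear set of δσ + σ⁷ would thus make the two
determinantal forms proportional after an invertible substitution in each slot. An invariant of such
forms rules this out: whether three consecutive slots can be filled with nonzero vectors so that the
form vanishes identically in the others. For the binomial this is possible, since row 1 of its
Dickson matrix has only two entries (`pencilForm_eq_zero_of_row`). For ψ it is impossible, by a few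
principal minors (`exists_det_circulantPencil_ne_zero`). -/

namespace ScatteredLinearSets

open Matrix

/-! ### Principal minors of the circulant pencil -/

/-- If the rows of a square matrix `D` outside the range of `c` are multiples of unit vectors,
then a singular `D` has a singular principal minor on the range of `c`. -/
theorem det_submatrix_eq_zero {m n : Type*} [Fintype m] [DecidableEq m] [Fintype n]
    [DecidableEq n] {K : Type*} [Field K] (D : Matrix n n K) (c : m → n)
    (hc : Function.Injective c) (hrow : ∀ i, i ∉ Set.range c → D i = Pi.single i (-1))
    (hD : D.det = 0) : (D.submatrix c c).det = 0 := by
  obtain ⟨v, hv0, hv⟩ := Matrix.exists_mulVec_eq_zero_iff.mpr hD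
  have hout : ∀ i, i ∉ Set.range c → v i = 0 := by
    intro i hi
    have h := congrFun hv i
    rw [Matrix.mulVec, hrow i hi] at h
    simpa using h
  refine Matrix.exists_mulVec_eq_zero_iff.mp ⟨v ∘ c, ?_, ?_⟩
  · intro h
    apply hv0
    ext i
    by_cases hi : i ∈ Set.range c
    · obtain ⟨k, rfl⟩ := hi
      exact congrFun h k
    · exact hout i hi
  · ext k
    have h := congrFun hv (c k)
    simp only [Matrix.mulVec, dotProduct, Pi.zero_apply] at h ⊢
    rw [← h]
    exact Fintype.sum_of_injective c hc _ _ (fun i hi => by simp [hout i hi]) (fun _ => rfl)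

/-- The matrix whose row `i` is `(u i).1` times the `i`-th cyclic shift of `a`, minus `(u i).2` times
the `i`-th unit vector. -/
def circulantPencil {K : Type*} [Field K] (a : Fin 8 → K) (u : Fin 8 → K × K) :
    Matrix (Fin 8) (Fin 8) K :=
  Matrix.of fun i j => (u i).1 * a (j - i) - (u i).2 * (Pi.single i 1 : Fin 8 → K) j

/-- A slot filled with (0, 1) contributes the row -eᵢ, so only the slots in the range of `c` matter.
-/
theorem det_minor_circulantPencil_eq_zero {K : Type*} [Field K] {m : ℕ} (a : Fin 8 → K)
    (u : Fin 8 → K × K) (c : Fin m → Fin 8) (hc : Function.Injective c)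
    (hu : ∀ i, u i = (0, 1) ∨ ∃ k, c k = i) (h : (circulantPencil a u).det = 0) :
    ((circulantPencil a u).submatrix c c).det = 0 := by
  refine det_submatrix_eq_zero _ c hc (fun i hi => ?_) h
  have hi' : u i = (0, 1) := (hu i).resolve_right hi
  ext j
  by_cases hij : j = i
  · subst hij; simp [circulantPencil, hi']
  · simp [circulantPencil, hi', hij]

/-- Each of the four `minor_eq_*` lemmas tests the vanishing at one filling of slots 3 to 7. The
name lists the slots that receive (1, 0); the others receive (0, 1). -/
theorem minor_eq_none {K : Type*} [Field K] (a : Fin 8 → K) (h0 : a 0 = 0) (h2 : a 2 = 0)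
    (h6 : a 6 = 0) (u₀ u₁ u₂ : K × K)
    (h : ∀ u : Fin 8 → K × K, u 0 = u₀ → u 1 = u₁ → u 2 = u₂ → (circulantPencil a u).det = 0) :
    u₀.2 * u₁.2 * u₂.2 -
      a 1 * a 7 * (u₀.2 * u₁.1 * u₂.1 + u₀.1 * u₁.1 * u₂.2) = 0 := by
  have e := det_minor_circulantPencil_eq_zero a ![u₀, u₁, u₂, (0, 1), (0, 1), (0, 1), (0, 1), (0, 1)]
    ![0, 1, 2] (by decide)
    (by intro i; fin_cases i <;> first | exact Or.inl rfl | exact Or.inr (by decide))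
    (h _ rfl rfl rfl)
  rw [show (circulantPencil a ![u₀, u₁, u₂, (0, 1), (0, 1), (0, 1), (0, 1), (0, 1)]).submatrix
      ![0, 1, 2] ![0, 1, 2] =
    !![-u₀.2, u₀.1 * a 1, 0;
      u₁.1 * a 7, -u₁.2, u₁.1 * a 1;
      0, u₂.1 * a 7, -u₂.2] by
    have n1 : (-1 : Fin 8) = 7 := rfl
    have n2 : (-2 : Fin 8) = 6 := rfl
    ext i j
    fin_cases i <;> fin_cases j <;> simp [circulantPencil, h0, h2, h6, n1, n2]] at e
  simp [det_fin_three] at e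
  linear_combination -e

theorem minor_eq_four {K : Type*} [Field K] (a : Fin 8 → K) (h0 : a 0 = 0) (h2 : a 2 = 0)
    (h4 : a 4 = 0) (h6 : a 6 = 0) (u₀ u₁ u₂ : K × K)
    (h : ∀ u : Fin 8 → K × K, u 0 = u₀ → u 1 = u₁ → u 2 = u₂ → (circulantPencil a u).det = 0) :
    a 3 * a 5 * (u₀.2 * u₁.1 * u₂.2) = 0 := by
  have e := det_minor_circulantPencil_eq_zero a ![u₀, u₁, u₂, (0, 1), (1, 0), (0, 1), (0, 1), (0, 1)]
    ![4, 0, 1, 2] (by decide)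
    (by intro i; fin_cases i <;> first | exact Or.inl rfl | exact Or.inr (by decide))
    (h _ rfl rfl rfl)
  rw [show (circulantPencil a ![u₀, u₁, u₂, (0, 1), (1, 0), (0, 1), (0, 1), (0, 1)]).submatrix
      ![4, 0, 1, 2] ![4, 0, 1, 2] =
    !![0, 0, a 5, 0;
      0, -u₀.2, u₀.1 * a 1, 0;
      u₁.1 * a 3, u₁.1 * a 7, -u₁.2, u₁.1 * a 1;
      0, 0, u₂.1 * a 7, -u₂.2] by
    have n1 : (-1 : Fin 8) = 7 := rfl
    have n2 : (-2 : Fin 8) = 6 := rfl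
    have n4 : (-4 : Fin 8) = 4 := rfl
    ext i j
    fin_cases i <;> fin_cases j <;> simp [circulantPencil, h0, h2, h4, h6, n1, n2, n4]] at e
  simp [det_succ_row_zero, Fin.sum_univ_succ, Fin.succAbove] at e
  simp only [mul_eq_zero]
  tauto

theorem minor_eq_five {K : Type*} [Field K] (a : Fin 8 → K) (h0 : a 0 = 0) (h2 : a 2 = 0)
    (h4 : a 4 = 0) (h6 : a 6 = 0) (u₀ u₁ u₂ : K × K)
    (h : ∀ u : Fin 8 → K × K, u 0 = u₀ → u 1 = u₁ → u 2 = u₂ → (circulantPencil a u).det = 0) :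
    a 3 * a 5 * (u₀.2 * u₁.2 * u₂.1 + u₀.1 * u₁.2 * u₂.2) +
      (a 1 * a 3 - a 5 * a 7) ^ 2 * (u₀.1 * u₁.1 * u₂.1) = 0 := by
  have e := det_minor_circulantPencil_eq_zero a ![u₀, u₁, u₂, (0, 1), (0, 1), (1, 0), (0, 1), (0, 1)]
    ![5, 0, 1, 2] (by decide)
    (by intro i; fin_cases i <;> first | exact Or.inl rfl | exact Or.inr (by decide))
    (h _ rfl rfl rfl)
  rw [show (circulantPencil a ![u₀, u₁, u₂, (0, 1), (0, 1), (1, 0), (0, 1), (0, 1)]).submatrix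
      ![5, 0, 1, 2] ![5, 0, 1, 2] =
    !![0, a 3, 0, a 5;
      u₀.1 * a 5, -u₀.2, u₀.1 * a 1, 0;
      0, u₁.1 * a 7, -u₁.2, u₁.1 * a 1;
      u₂.1 * a 3, 0, u₂.1 * a 7, -u₂.2] by
    have n1 : (-1 : Fin 8) = 7 := rfl
    have n2 : (-2 : Fin 8) = 6 := rfl
    ext i j
    fin_cases i <;> fin_cases j <;> simp [circulantPencil, h0, h2, h4, h6, n1, n2] <;> rfl] at e
  simp [det_succ_row_zero, Fin.sum_univ_succ, Fin.succAbove] at e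
  linear_combination -e

theorem minor_eq_three_seven {K : Type*} [Field K] (a : Fin 8 → K) (h0 : a 0 = 0) (h2 : a 2 = 0)
    (h4 : a 4 = 0) (h6 : a 6 = 0) (u₀ u₁ u₂ : K × K)
    (h : ∀ u : Fin 8 → K × K, u 0 = u₀ → u 1 = u₁ → u 2 = u₂ → (circulantPencil a u).det = 0) :
    (a 1 * a 7 - a 3 * a 5) ^ 2 * (u₀.1 * u₁.2 * u₂.1) = 0 := by
  have e := det_minor_circulantPencil_eq_zero a ![u₀, u₁, u₂, (1, 0), (0, 1), (0, 1), (0, 1), (1, 0)]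
    ![3, 7, 0, 1, 2] (by decide)
    (by intro i; fin_cases i <;> first | exact Or.inl rfl | exact Or.inr (by decide))
    (h _ rfl rfl rfl)
  rw [show (circulantPencil a ![u₀, u₁, u₂, (1, 0), (0, 1), (0, 1), (0, 1), (1, 0)]).submatrix
      ![3, 7, 0, 1, 2] ![3, 7, 0, 1, 2] =
    !![0, 0, a 5, 0, a 7;
      0, 0, a 1, 0, a 3;
      u₀.1 * a 3, u₀.1 * a 7, -u₀.2, u₀.1 * a 1, 0;
      0, 0, u₁.1 * a 7, -u₁.2, u₁.1 * a 1;
      u₂.1 * a 1, u₂.1 * a 5, 0, u₂.1 * a 7, -u₂.2] by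
    have n1 : (-1 : Fin 8) = 7 := rfl
    have n2 : (-2 : Fin 8) = 6 := rfl
    ext i j
    fin_cases i <;> fin_cases j <;> simp [circulantPencil, h0, h2, h4, h6, n1, n2] <;> rfl] at e
  simp [det_succ_row_zero, Fin.sum_univ_succ, Fin.succAbove] at e
  linear_combination -e

/-- No three consecutive slots of the multilinear form `det ∘ circulantPencil a` can be filled by
nonzero vectors so that the form vanishes identically in the remaining slots. -/
theorem exists_det_circulantPencil_ne_zero {K : Type*} [Field K] (a : Fin 8 → K) (h0 : a 0 = 0)
    (h2 : a 2 = 0) (h4 : a 4 = 0) (h6 : a 6 = 0) (h17 : a 1 * a 7 ≠ 0) (h35 : a 3 * a 5 ≠ 0)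
    (hne : a 1 * a 3 - a 5 * a 7 ≠ 0) (hne' : a 1 * a 7 - a 3 * a 5 ≠ 0) (u₀ u₁ u₂ : K × K)
    (hu₀ : u₀ ≠ 0) (hu₁ : u₁ ≠ 0) (hu₂ : u₂ ≠ 0) :
    ∃ u : Fin 8 → K × K, u 0 = u₀ ∧ u 1 = u₁ ∧ u 2 = u₂ ∧ (circulantPencil a u).det ≠ 0 := by
  by_contra! h
  have e1 := minor_eq_none a h0 h2 h6 u₀ u₁ u₂ h
  have e2 := minor_eq_four a h0 h2 h4 h6 u₀ u₁ u₂ h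
  have e3 := minor_eq_five a h0 h2 h4 h6 u₀ u₁ u₂ h
  have e4 := minor_eq_three_seven a h0 h2 h4 h6 u₀ u₁ u₂ h
  obtain ⟨y₀, z₀⟩ := u₀
  obtain ⟨y₁, z₁⟩ := u₁
  obtain ⟨y₂, z₂⟩ := u₂
  simp only [ne_eq, Prod.mk_eq_zero, mul_eq_zero, not_or] at *
  have hsq : (a 1 * a 3 - a 5 * a 7) ^ 2 ≠ 0 := pow_ne_zero 2 hne
  have hsq' : (a 1 * a 7 - a 3 * a 5) ^ 2 ≠ 0 := pow_ne_zero 2 hne'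
  -- Whichever of y₁, z₁ are nonzero, the four equations force z₀z₂ = y₀y₂ = y₀z₂ + z₀y₂ = 0. Then
  -- (y₀X + z₀)(y₂X + z₂) = 0, although neither factor is zero.
  by_cases hy₀ : y₀ = 0 <;> by_cases hy₁ : y₁ = 0 <;> by_cases hy₂ : y₂ = 0 <;>
    by_cases hz₀ : z₀ = 0 <;> by_cases hz₁ : z₁ = 0 <;> by_cases hz₂ : z₂ = 0 <;>
    simp_all

/-! ### Multilinear forms on conjugates, and Dickson determinants -/

section

variable {K : Type*} [Field K]

/-- A multilinear form in the coordinates of vectors of `K ^ 2` that vanishes at `(0, 1)` in all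
slots, and at the vectors `(1, w ^ (q ^ e i))` for at least `∑ i, q ^ e i` values of `w`, is zero. -/
theorem multilinearMap_eq_zero_of_many_zeros {n q : ℕ} (hq : 2 ≤ q) (e : Fin n → ℕ)
    (he : Function.Injective e) (H : MultilinearMap K (fun _ : Fin n => K × K) K)
    (hinf : H (fun _ => (0, 1)) = 0) (L : Finset K) (hL : ∑ i, q ^ e i ≤ L.card)
    (hzero : ∀ w ∈ L, H (fun i => (1, w ^ q ^ e i)) = 0) : H = 0 := by
  classical
  let E : Finset (Fin n) → ℕ := fun s => ∑ i ∈ s, q ^ e i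
  -- Uniqueness of base-q expansions with digits 0 and 1: distinct subsets give distinct exponents.
  have hE : Function.Injective E := by
    intro s t hst
    have h := Finset.geomSum_injective hq (a₁ := s.map ⟨e, he⟩) (a₂ := t.map ⟨e, he⟩)
      (by simpa [E] using hst)
    exact Finset.map_injective _ h
  let b : Finset (Fin n) → (Fin n → K × K) := fun s => s.piecewise (fun _ => (0, 1)) fun _ => (1, 0)
  let p : Polynomial K := ∑ s, Polynomial.monomial (E s) (H (b s))
  have hcoeff : ∀ s, p.coeff (E s) = H (b s) := by
    intro s
    simp [p, Polynomial.coeff_monomial, hE.eq_iff]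
  -- The coefficient of top exponent is the value at (0, 1) in all slots, which is zero; this saves
  -- the one root needed.
  have hdeg : p.degree < (E Finset.univ : ℕ) := by
    refine (Polynomial.degree_lt_iff_coeff_zero _ _).mpr fun m hm => ?_
    rw [Polynomial.finsetSum_coeff]
    refine Finset.sum_eq_zero fun s _ => ?_
    rw [Polynomial.coeff_monomial]
    split_ifs with hs
    · have hsu : s = Finset.univ := by
        by_contra hne
        obtain ⟨i, hi⟩ : ∃ i, i ∉ s := by
          by_contra! hall
          exact hne (Finset.eq_univ_iff_forall.mpr hall)
        have : E s < E Finset.univ :=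
          Finset.sum_lt_sum_of_subset (Finset.subset_univ s) (Finset.mem_univ i) hi
            (by positivity) (fun _ _ _ => Nat.zero_le _)
        omega
      subst hsu
      simpa [b] using hinf
    · rfl
  have heval : ∀ w, p.eval w = H (fun i => (1, w ^ q ^ e i)) := by
    intro w
    have h := H.map_add_univ (fun i => w ^ q ^ e i • ((0, 1) : K × K)) (fun _ => ((1, 0) : K × K))
    have h' : ((fun i => w ^ q ^ e i • ((0, 1) : K × K)) + fun _ => ((1, 0) : K × K)) =
        fun i => (1, w ^ q ^ e i) := by
      ext i <;> simp
    rw [h'] at h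
    rw [h, Polynomial.eval_finsetSum]
    refine Finset.sum_congr rfl fun s _ => ?_
    have h2 : s.piecewise (fun i => w ^ q ^ e i • ((0, 1) : K × K)) (fun _ => ((1, 0) : K × K)) =
        s.piecewise (fun i => w ^ q ^ e i • b s i) (b s) := by
      ext i <;> by_cases hi : i ∈ s <;> simp [b, hi]
    rw [h2, MultilinearMap.map_piecewise_smul, Finset.prod_pow_eq_pow_sum, Polynomial.eval_monomial,
      smul_eq_mul, mul_comm]
  have hp : p = 0 := by
    refine Polynomial.eq_zero_of_degree_lt_of_eval_finset_eq_zero L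
      (hdeg.trans_le (by exact_mod_cast hL)) fun w hw => ?_
    rw [heval, hzero w hw]
  refine Module.Basis.ext_multilinear (fun _ => Module.Basis.finTwoProd K) fun v => ?_
  have hv : (fun i => Module.Basis.finTwoProd K (v i)) = b {i | v i = 1} := by
    ext i <;> by_cases hi : v i = 1
    · simp [b, hi]
    · have : v i = 0 := by omega
      simp [b, this]
    · simp [b, hi]
    · have : v i = 0 := by omega
      simp [b, this]
  rw [hv, ← hcoeff, hp]
  simp

/-- The linear map `(y, z) ↦ y • r - z • e i`. -/
def rowMap {n : Type*} [DecidableEq n] (r : n → K) (i : n) : K × K →ₗ[K] (n → K) :=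
  (LinearMap.fst K K K).smulRight r - (LinearMap.snd K K K).smulRight (Pi.single i 1)

/-- The determinant of the matrix with rows `y i • r i - z i • e i`, as a multilinear form
in the vectors `(y i, z i)`. -/
noncomputable def pencilForm {n : Type*} [Fintype n] [DecidableEq n] (r : n → n → K) :
    MultilinearMap K (fun _ : n => K × K) K :=
  (Matrix.detRowAlternating (n := n) (R := K)).toMultilinearMap.compLinearMap
    fun i => rowMap (r i) i

theorem pencilForm_apply {n : Type*} [Fintype n] [DecidableEq n] (r : n → n → K) (u : n → K × K) :
    pencilForm r u =
      (Matrix.of fun i j => (u i).1 * r i j - (u i).2 * (Pi.single i 1 : n → K) j).det := by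
  simp only [pencilForm, MultilinearMap.compLinearMap_apply]
  rfl

theorem pencilForm_infinity {n : Type*} [Fintype n] [DecidableEq n] (r : n → n → K) :
    pencilForm r (fun _ => (0, 1)) = (-1) ^ Fintype.card n := by
  rw [pencilForm_apply, show (Matrix.of fun i j => ((0, 1) : K × K).1 * r i j -
    ((0, 1) : K × K).2 * (Pi.single i 1 : n → K) j) = -(1 : Matrix n n K) by
      ext i j
      simp [Matrix.one_apply, Pi.single_apply, eq_comm], Matrix.det_neg, Matrix.det_one, mul_one]

/-- If row `k` is a combination of the unit vectors `e i` and `e j`, the form vanishes whenever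
the slots `i`, `k`, `j` are filled by `(0, 1)`, `(1, 0)`, `(0, 1)`. -/
theorem pencilForm_eq_zero_of_row {n : Type*} [Fintype n] [DecidableEq n] (r : n → n → K)
    (u : n → K × K) {i j k : n} (hik : i ≠ k) (hjk : j ≠ k) (b c : K)
    (hr : r k = b • Pi.single i 1 + c • Pi.single j 1) (hi : u i = (0, 1)) (hk : u k = (1, 0))
    (hj : u j = (0, 1)) : pencilForm r u = 0 := by
  rw [pencilForm_apply]
  -- Rows i and j are -eᵢ and -eⱼ, so they cancel row k = b eᵢ + c eⱼ.
  refine Matrix.exists_vecMul_eq_zero_iff.mp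
    ⟨Pi.single k 1 + b • Pi.single i 1 + c • Pi.single j 1, fun h => ?_, ?_⟩
  · have := congrFun h k
    simp [hik.symm, hjk.symm] at this
  · ext l
    rw [Matrix.add_vecMul, Matrix.add_vecMul, Matrix.smul_vecMul, Matrix.smul_vecMul]
    simp [hi, hj, hk, hr]

/-- The rows of the Dickson matrix of `x ↦ ∑ j, c j * (σ ^ j) x`. -/
def dicksonRow {F : Type*} [Field F] [Algebra F K] (σ : K ≃ₐ[F] K) (c : Fin 8 → K) :
    Fin 8 → Fin 8 → K :=
  fun i j => (σ ^ (i : ℕ)) (c (j - i))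

theorem pow_apply_pow_sub {F : Type*} [Field F] [Algebra F K] (σ : K ≃ₐ[F] K) (hσ : σ ^ 8 = 1)
    (i j : Fin 8) (x : K) : (σ ^ (i : ℕ)) ((σ ^ ((j - i : Fin 8) : ℕ)) x) = (σ ^ (j : ℕ)) x := by
  rw [← AlgEquiv.mul_apply, ← pow_add, pow_eq_pow_mod _ hσ, ← Fin.val_add, add_sub_cancel]

/-- The coordinatewise action of an automorphism of `K` on `K ^ 2`. -/
def mapPair {F : Type*} [Field F] [Algebra F K] (σ : K ≃ₐ[F] K) (v : K × K) : K × K :=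
  (σ v.1, σ v.2)

theorem mapPair_ne_zero {F : Type*} [Field F] [Algebra F K] (σ : K ≃ₐ[F] K) {v : K × K}
    (hv : v ≠ 0) : mapPair σ v ≠ 0 := by
  intro h
  obtain ⟨h1, h2⟩ := Prod.ext_iff.mp h
  exact hv (Prod.ext ((map_eq_zero_iff _ σ.injective).mp h1)
    ((map_eq_zero_iff _ σ.injective).mp h2))

/-- Applying σⁱ to the equation gives row i of a linear system solved by the vector of conjugates of
x. -/
theorem pencilForm_dicksonRow_eq_zero {F : Type*} [Field F] [Algebra F K] (σ : K ≃ₐ[F] K)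
    (hσ : σ ^ 8 = 1) (c : Fin 8 → K) {x : K} (v : K × K) (hx : x ≠ 0)
    (h : v.1 * ∑ j : Fin 8, c j * (σ ^ (j : ℕ)) x = v.2 * x) :
    pencilForm (dicksonRow σ c) (fun i => mapPair (σ ^ (i : ℕ)) v) = 0 := by
  obtain ⟨y, z⟩ := v
  rw [pencilForm_apply]
  refine Matrix.exists_mulVec_eq_zero_iff.mp ⟨fun j => (σ ^ (j : ℕ)) x, fun h0 => ?_, ?_⟩
  · exact hx (by simpa using congrFun h0 0)
  · ext i
    have h1 := congrArg (σ ^ (i : ℕ)) h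
    rw [map_mul, map_mul, map_sum] at h1
    have h2 : ∑ j : Fin 8, (σ ^ (i : ℕ)) (c j * (σ ^ (j : ℕ)) x) =
        ∑ j : Fin 8, (σ ^ (i : ℕ)) (c (j - i)) * (σ ^ (j : ℕ)) x := by
      refine (Fintype.sum_equiv (Equiv.subRight i) _ _ fun j => ?_).symm
      rw [Equiv.subRight_apply, map_mul, pow_apply_pow_sub σ hσ]
    rw [h2, Finset.mul_sum] at h1
    simp only [Matrix.mulVec, dotProduct, Matrix.of_apply, sub_mul, Finset.sum_sub_distrib,
      dicksonRow, mapPair, Pi.zero_apply]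
    rw [sub_eq_zero]
    simpa [mul_assoc, Pi.single_apply] using h1

theorem sum_binomialCoeff_mul {F : Type*} [Field F] [Algebra F K] (σ : K ≃ₐ[F] K) (δ x : K) :
    ∑ j : Fin 8, (Pi.single 1 δ + Pi.single 7 1 : Fin 8 → K) j * (σ ^ (j : ℕ)) x =
      δ * σ x + (σ ^ 7) x := by
  simp [add_mul, Finset.sum_add_distrib, Pi.single_apply]

theorem dicksonRow_binomial {F : Type*} [Field F] [Algebra F K] (σ : K ≃ₐ[F] K) (δ : K) :
    dicksonRow σ (Pi.single 1 δ + Pi.single 7 1) 1 =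
      (1 : K) • Pi.single 0 1 + σ δ • Pi.single 2 1 := by
  ext j
  have h : ∀ j : Fin 8, (j - 1 = 1 ↔ j = 2) ∧ (j - 1 = 7 ↔ j = 0) := by decide
  simp only [dicksonRow, Fin.val_one, pow_one, Pi.add_apply, Pi.single_apply, h, map_add,
    Pi.smul_apply, smul_eq_mul]
  split_ifs <;> simp [add_comm]

theorem dicksonRow_of_fixed {F : Type*} [Field F] [Algebra F K] (σ : K ≃ₐ[F] K) (a : Fin 8 → K)
    (ha : ∀ j, σ (a j) = a j) : dicksonRow σ a = fun i j => a (j - i) := by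
  ext i j
  have : ∀ n : ℕ, ∀ l, (σ ^ n) (a l) = a l := by
    intro n l
    induction n with
    | zero => simp
    | succ n ih => rw [pow_succ, AlgEquiv.mul_apply, ha, ih]
  exact this _ _

end

/-! ### Scatteredness of ψ -/

section

variable {F K : Type*} [Field F] [Field K] [Algebra F K]

/-- The map `x ↦ (τ (x - τ⁴ x) + τ³ (x + τ⁴ x)) / 2` for an automorphism `τ`. -/
def autPsi (τ : K ≃ₐ[F] K) (x : K) : K :=
  2⁻¹ * (τ (x - (τ ^ 4) x) + (τ ^ 3) (x + (τ ^ 4) x))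

/-- Since τ⁴ commutes with τ and is an involution, adding the equation to its τ⁴-conjugate, or
subtracting it, separates the parts fixed and negated by τ⁴. -/
theorem autPsi_components (h2 : (2 : K) ≠ 0) (τ : K ≃ₐ[F] K) (hτ : τ ^ 8 = 1) {m x : K}
    (hx : autPsi τ x = m * x) :
    (τ ^ 3) (x + (τ ^ 4) x) = 2⁻¹ * ((m + (τ ^ 4) m) * (x + (τ ^ 4) x) +
      (m - (τ ^ 4) m) * (x - (τ ^ 4) x)) ∧
    τ (x - (τ ^ 4) x) = 2⁻¹ * ((m + (τ ^ 4) m) * (x - (τ ^ 4) x) +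
      (m - (τ ^ 4) m) * (x + (τ ^ 4) x)) := by
  have h8 : ∀ z, (τ ^ 4) ((τ ^ 4) z) = z := fun z => by
    rw [← AlgEquiv.mul_apply, ← pow_add, hτ, AlgEquiv.one_apply]
  have h3 : ∀ z, (τ ^ 4) ((τ ^ 3) z) = (τ ^ 3) ((τ ^ 4) z) := fun z => by
    rw [← AlgEquiv.mul_apply, ← AlgEquiv.mul_apply, ← pow_add, ← pow_add]
  have h1 : ∀ z, (τ ^ 4) (τ z) = τ ((τ ^ 4) z) := fun z => by
    rw [← AlgEquiv.mul_apply, ← AlgEquiv.mul_apply, ← pow_succ, ← pow_succ']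
  have h24 : (τ ^ 4) 2 = 2 := map_ofNat (τ ^ 4) 2
  have hx' : (τ ^ 4) (autPsi τ x) = (τ ^ 4) (m * x) := by rw [hx]
  simp only [autPsi, map_mul, map_add, map_sub, map_inv₀, h24, h8, h3, h1] at hx hx' ⊢
  field_simp at hx hx' ⊢
  constructor
  · linear_combination hx + hx'
  · linear_combination hx - hx'

/-- `autPsi τ` is scattered: two vectors with the same slope are proportional by a factor that `τ`
fixes. -/
theorem autPsi_scattered (h2 : (2 : K) ≠ 0) (τ : K ≃ₐ[F] K) (hτ : τ ^ 8 = 1) {m x y : K}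
    (hx0 : x ≠ 0) (hx : autPsi τ x = m * x) (hy : autPsi τ y = m * y) : τ x * y = τ y * x := by
  obtain ⟨hx1, hx2⟩ := autPsi_components h2 τ hτ hx
  obtain ⟨hy1, hy2⟩ := autPsi_components h2 τ hτ hy
  have h8 : ∀ z, (τ ^ 4) ((τ ^ 4) z) = z := fun z => by
    rw [← AlgEquiv.mul_apply, ← pow_add, hτ, AlgEquiv.one_apply]
  have h13 : ∀ z, τ ((τ ^ 3) z) = (τ ^ 4) z := fun z => by
    rw [← AlgEquiv.mul_apply, ← pow_succ']
  have ht2 : τ 2 = 2 := map_ofNat τ 2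
  have h1111 : ∀ z, (τ ^ 4) z = τ (τ (τ (τ z))) := fun z => by
    simp only [pow_succ, pow_zero, one_mul, AlgEquiv.mul_apply]
  have hplus : ∀ z, (τ ^ 4) (z + (τ ^ 4) z) = z + (τ ^ 4) z := fun z => by
    rw [map_add, h8, add_comm]
  have hminus : ∀ z, (τ ^ 4) (z - (τ ^ 4) z) = -(z - (τ ^ 4) z) := fun z => by
    rw [map_sub, h8, neg_sub]
  have hex : x = 2⁻¹ * ((x + (τ ^ 4) x) + (x - (τ ^ 4) x)) := by field_simp; ring
  have hey : y = 2⁻¹ * ((y + (τ ^ 4) y) + (y - (τ ^ 4) y)) := by field_simp; ring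
  have hbx1 := hplus x
  have hbx2 := hminus x
  have hby1 := hplus y
  have hby2 := hminus y
  have hbm1 := hplus m
  have hbm2 := hminus m
  generalize x + (τ ^ 4) x = x₁ at *
  generalize x - (τ ^ 4) x = x₂ at *
  generalize y + (τ ^ 4) y = y₁ at *
  generalize y - (τ ^ 4) y = y₂ at *
  generalize m + (τ ^ 4) m = m₁ at *
  generalize m - (τ ^ 4) m = m₂ at *
  have hsx : x₁ = 2⁻¹ * (τ m₁ * τ x₁ + τ m₂ * τ x₂) := by
    conv_lhs => rw [← hbx1, ← h13, hx1]
    simp only [map_mul, map_add, map_inv₀, ht2]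
  have hsy : y₁ = 2⁻¹ * (τ m₁ * τ y₁ + τ m₂ * τ y₂) := by
    conv_lhs => rw [← hby1, ← h13, hy1]
    simp only [map_mul, map_add, map_inv₀, ht2]
  -- If m₁ = 0, then m₂ τ(m₂) = 4, so τ² and hence τ⁴ fix m₂. But τ⁴ negates m₂, which is nonzero.
  by_cases hm : m₁ = 0
  · exfalso
    subst hm
    simp only [zero_mul, map_zero, zero_add] at hsx hx2
    have hx1' : x₁ ≠ 0 := by
      intro h
      rw [h, mul_zero, mul_zero, map_eq_zero_iff _ τ.injective] at hx2
      rw [h, hx2] at hex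
      exact hx0 (by simpa using hex)
    have hn : τ m₂ * m₂ = 4 := by
      rw [hx2] at hsx
      field_simp at hsx
      linear_combination -hsx
    have hn' : τ (τ m₂) * τ m₂ = 4 := by
      rw [← map_mul, hn, map_ofNat]
    have h4 : (4 : K) ≠ 0 := by
      rw [show (4 : K) = 2 * 2 by norm_num]
      exact mul_ne_zero h2 h2
    have hm2 : m₂ ≠ 0 := by
      rintro rfl
      exact h4 (by simpa using hn.symm)
    have htm2 : τ m₂ ≠ 0 := by simpa using hm2
    have htt : τ (τ m₂) = m₂ :=
      mul_right_cancel₀ htm2 (by rw [hn', ← hn, mul_comm])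
    have : (τ ^ 4) m₂ = m₂ := by
      rw [h1111, htt, htt]
    rw [this] at hbm2
    exact hm2 ((mul_eq_zero.mp (by linear_combination hbm2 : (2 : K) * m₂ = 0)).resolve_left h2)
  · have htm : τ m₁ ≠ 0 := by simpa using hm
    have e1 : τ m₁ * τ x₁ = 2 * x₁ - τ m₂ * τ x₂ := by
      field_simp at hsx
      linear_combination -hsx
    have e2 : τ m₁ * τ y₁ = 2 * y₁ - τ m₂ * τ y₂ := by
      field_simp at hsy
      linear_combination -hsy
    -- With W = x₁y₂ - x₂y₁, this says that τ fixes m₁W. As τ⁴ negates m₁W, it follows that W = 0.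
    have hΔ : τ m₁ * (τ x₁ * τ y₂ - τ x₂ * τ y₁) = m₁ * (x₁ * y₂ - x₂ * y₁) := by
      field_simp at hx2 hy2
      linear_combination τ y₂ * e1 - τ x₂ * e2 + x₁ * hy2 - y₁ * hx2
    have hfix : τ (m₁ * (x₁ * y₂ - x₂ * y₁)) = m₁ * (x₁ * y₂ - x₂ * y₁) := by
      simp only [map_mul, map_sub, hΔ]
    have hbar : (τ ^ 4) (m₁ * (x₁ * y₂ - x₂ * y₁)) = -(m₁ * (x₁ * y₂ - x₂ * y₁)) := by
      simp only [map_mul, map_sub, hbm1, hbx1, hbx2, hby1, hby2]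
      ring
    have hbar' : (τ ^ 4) (m₁ * (x₁ * y₂ - x₂ * y₁)) = m₁ * (x₁ * y₂ - x₂ * y₁) := by
      rw [h1111, hfix, hfix, hfix, hfix]
    have hW : x₁ * y₂ - x₂ * y₁ = 0 := by
      rw [hbar'] at hbar
      have h0 : (2 * m₁) * (x₁ * y₂ - x₂ * y₁) = 0 := by linear_combination hbar
      exact (mul_eq_zero.mp h0).resolve_left (mul_ne_zero h2 hm)
    apply mul_left_cancel₀ htm
    have ex : τ x = 2⁻¹ * (τ x₁ + τ x₂) := by rw [hex]; simp [ht2]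
    have ey : τ y = 2⁻¹ * (τ y₁ + τ y₂) := by rw [hey]; simp [ht2]
    have key : τ m₁ * ((τ x₁ + τ x₂) * (y₁ + y₂)) = τ m₁ * ((τ y₁ + τ y₂) * (x₁ + x₂)) := by
      linear_combination (y₁ + y₂) * e1 - (x₁ + x₂) * e2 + (τ m₁ - τ m₂) * (y₁ + y₂) * hx2 -
        (τ m₁ - τ m₂) * (x₁ + x₂) * hy2 + (2 + (τ m₁ - τ m₂) * 2⁻¹ * (m₂ - m₁)) * hW
    rw [ex, ey, hex, hey]
    linear_combination 2⁻¹ * 2⁻¹ * key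

end

/-! ### Counting slopes and comparing the two forms -/

section

variable {F K : Type*} [Field F] [Field K] [Algebra F K]

/-- A map whose graph is scattered over `q` elements determines `(q ^ n - 1) / (q - 1)` slopes. -/
theorem sum_pow_le_card_slopes [Fintype K] [DecidableEq K] {q n : ℕ} (hq : 2 ≤ q)
    (hK : Fintype.card K = q ^ n) (f : K → K)
    (hf : ∀ m x y, x ≠ 0 → y ≠ 0 → f x = m * x → f y = m * y → (x / y) ^ q = x / y) :
    ∑ i ∈ Finset.range n, q ^ i ≤ ((Finset.univ.erase (0 : K)).image fun x => f x / x).card := by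
  have hcard := Finset.card_le_mul_card_image (f := fun x => f x / x) (Finset.univ.erase (0 : K))
    (q - 1) ?_
  · rw [Finset.card_erase_of_mem (Finset.mem_univ _), Finset.card_univ, hK] at hcard
    have hgeom := Nat.geomSum_eq hq n
    have hpos : 0 < q - 1 := by omega
    rw [hgeom]
    exact Nat.div_le_of_le_mul hcard
  · intro m hm
    obtain ⟨y, hy, rfl⟩ := Finset.mem_image.mp hm
    have hy0 : y ≠ 0 := (Finset.mem_erase.mp hy).1
    -- Dividing a fibre by one of its elements embeds it in the (q - 1)-th roots of unity.
    refine le_trans (le_trans ?_ (Multiset.toFinset_card_le _))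
      (Polynomial.card_nthRoots (q - 1) (1 : K))
    refine Finset.card_le_card_of_injOn (fun x => x / y) ?_ ?_
    · intro x hx
      obtain ⟨hx1, hx2⟩ := Finset.mem_filter.mp hx
      have hx0 : x ≠ 0 := (Finset.mem_erase.mp hx1).1
      have h := hf (f y / y) x y hx0 hy0 (by rw [← hx2, div_mul_cancel₀ _ hx0])
        (by rw [div_mul_cancel₀ _ hy0])
      have hz : x / y ≠ 0 := div_ne_zero hx0 hy0
      simp only [Finset.mem_coe, Multiset.mem_toFinset]
      rw [Polynomial.mem_nthRoots (by omega)]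
      apply mul_right_cancel₀ hz
      rw [← pow_succ, Nat.sub_add_cancel (by omega), h, one_mul]
    · intro x _ x' _ h
      exact (div_left_inj' hy0).mp h

theorem exists_pencilForm_comp {n : Type*} [Fintype n] [DecidableEq n] (r : n → n → K)
    (M : n → (K × K →ₗ[K] K × K)) : ∃ G : MultilinearMap K (fun _ : n => K × K) K,
      ∀ u v, (∀ i, M i (u i) = v i) → G u = pencilForm r v :=
  ⟨(pencilForm r).compLinearMap M, fun u v h => by
    rw [MultilinearMap.compLinearMap_apply, funext h]⟩

theorem pencilForm_shift (a : Fin 8 → K) (u : Fin 8 → K × K) :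
    pencilForm (fun i j => a (j - i)) u = (circulantPencil a u).det := by
  rw [pencilForm_apply, circulantPencil]

/-- The linear set of a scattered map `x ↦ ∑ j, a j * (σ ^ j) x`, with odd exponents and
coefficients fixed by `σ`, is not sent by an invertible matrix with columns `P`, `R` to that of
`δ * σ x + σ ^ 7 x`. -/
theorem false_of_slopes_to_binomial {q : ℕ} (hq : 2 ≤ q) (σ : K ≃ₐ[F] K) (hσ : σ ^ 8 = 1)
    (e : Fin 8 → ℕ) (he : Function.Injective e)
    (hpow : ∀ (i : Fin 8) (x : K), (σ ^ (i : ℕ)) x = x ^ q ^ e i)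
    (a : Fin 8 → K) (ha : ∀ j, σ (a j) = a j) (h0 : a 0 = 0)
    (h2 : a 2 = 0) (h4 : a 4 = 0) (h6 : a 6 = 0) (h17 : a 1 * a 7 ≠ 0) (h35 : a 3 * a 5 ≠ 0)
    (hne : a 1 * a 3 - a 5 * a 7 ≠ 0) (hne' : a 1 * a 7 - a 3 * a 5 ≠ 0)
    (L : Finset K) (hL : ∑ i, q ^ e i ≤ L.card)
    (hslope : ∀ w ∈ L, ∃ x, x ≠ 0 ∧ ∑ j : Fin 8, a j * (σ ^ (j : ℕ)) x = w * x)
    (δ : K) (P R : K × K) (hsurj : ∀ v : K × K, ∃ u : K × K, u.1 • P + u.2 • R = v)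
    (hmap : ∀ w ∈ L, ∃ x, x ≠ 0 ∧
      (P + w • R).1 * (δ * σ x + (σ ^ 7) x) = (P + w • R).2 * x) : False := by
  -- `M i` is the i-th conjugate of the matrix with columns `P`, `R`; `G` is the binomial's form
  -- after this substitution.
  obtain ⟨M, hM⟩ : ∃ M : Fin 8 → (K × K →ₗ[K] K × K), ∀ (i : Fin 8) (u : K × K),
      M i (mapPair (σ ^ (i : ℕ)) u) = mapPair (σ ^ (i : ℕ)) (u.1 • P + u.2 • R) :=
    ⟨fun i => (LinearMap.fst K K K).smulRight (mapPair (σ ^ (i : ℕ)) P) +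
      (LinearMap.snd K K K).smulRight (mapPair (σ ^ (i : ℕ)) R), fun i u => by simp [mapPair]⟩
  obtain ⟨c, hcsum, hcrow⟩ : ∃ c : Fin 8 → K,
      (∀ x, ∑ j : Fin 8, c j * (σ ^ (j : ℕ)) x = δ * σ x + (σ ^ 7) x) ∧
      dicksonRow σ c 1 = (1 : K) • Pi.single 0 1 + σ δ • Pi.single 2 1 :=
    ⟨_, sum_binomialCoeff_mul σ δ, dicksonRow_binomial σ δ⟩
  obtain ⟨G, hG⟩ : ∃ G : MultilinearMap K (fun _ : Fin 8 => K × K) K,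
      ∀ u v, (∀ i, M i (u i) = v i) → G u = pencilForm (dicksonRow σ c) v :=
    exists_pencilForm_comp _ M
  have hone : ∀ r : Fin 8 → Fin 8 → K, pencilForm r (fun _ => (0, 1)) = 1 := by
    intro r
    rw [pencilForm_infinity, Fintype.card_fin]
    norm_num
  have hGs : ∀ v, G (fun i => mapPair (σ ^ (i : ℕ)) v) =
      pencilForm (dicksonRow σ c) (fun i => mapPair (σ ^ (i : ℕ)) (v.1 • P + v.2 • R)) :=
    fun v => hG _ _ fun i => hM i v
  have hs01 : ∀ i : Fin 8, mapPair (σ ^ (i : ℕ)) (0, 1) = (0, 1) := fun i => by simp [mapPair]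
  have hs10 : ∀ i : Fin 8, mapPair (σ ^ (i : ℕ)) (1, 0) = (1, 0) := fun i => by simp [mapPair]
  -- The form of f is 1 at (0, 1) in all slots, so the scalar cancels the top coefficient. Both
  -- forms vanish at the conjugates of (1, w) for w in `L`.
  have hGA : G = G (fun _ => (0, 1)) • pencilForm (dicksonRow σ a) := by
    rw [← sub_eq_zero]
    refine multilinearMap_eq_zero_of_many_zeros hq e he _ ?_ L hL fun w hw => ?_
    · rw [_root_.sub_apply, _root_.smul_apply, hone, smul_eq_mul, mul_one, sub_self]
    · have hs : (fun i : Fin 8 => ((1 : K), w ^ q ^ e i)) =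
          fun i : Fin 8 => mapPair (σ ^ (i : ℕ)) (1, w) := by
        funext i
        simp only [mapPair, hpow, one_pow]
      obtain ⟨x, hx, hxw⟩ := hslope w hw
      obtain ⟨x', hx', hxw'⟩ := hmap w hw
      have hA := pencilForm_dicksonRow_eq_zero σ hσ a (1, w) hx (by rw [hxw, one_mul])
      have hG := pencilForm_dicksonRow_eq_zero σ hσ c (P + w • R) hx' (by rw [hcsum, hxw'])
      rw [hs, _root_.sub_apply, _root_.smul_apply, hA, hGs, one_smul, hG, smul_zero, sub_zero]
  obtain ⟨u, hu⟩ := hsurj (0, 1)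
  obtain ⟨v, hv⟩ := hsurj (1, 0)
  have hGu : G (fun i => mapPair (σ ^ (i : ℕ)) u) = 1 := by
    rw [hGs, hu]
    simp only [hs01, hone]
  have hlead : G (fun _ => (0, 1)) ≠ 0 := by
    intro h
    rw [hGA, h, zero_smul, _root_.zero_apply] at hGu
    exact zero_ne_one hGu
  have hu0 : u ≠ 0 := by rintro rfl; simp [Prod.ext_iff] at hu
  have hv0 : v ≠ 0 := by rintro rfl; simp [Prod.ext_iff] at hv
  -- Under `M`, slots 0, 1, 2 become (0, 1), (1, 0), (0, 1), the filling that kills the binomial's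
  -- form.
  obtain ⟨U, hU0, hU1, hU2, hU⟩ := exists_det_circulantPencil_ne_zero a h0 h2 h4 h6 h17 h35 hne hne'
    (mapPair (σ ^ ((0 : Fin 8) : ℕ)) u) (mapPair (σ ^ ((1 : Fin 8) : ℕ)) v)
    (mapPair (σ ^ ((2 : Fin 8) : ℕ)) u)
    (mapPair_ne_zero _ hu0) (mapPair_ne_zero _ hv0) (mapPair_ne_zero _ hu0)
  have hGU : G U = 0 := by
    rw [hG U _ fun _ => rfl]
    exact pencilForm_eq_zero_of_row _ _ (i := 0) (k := 1) (j := 2) (by decide) (by decide) 1 (σ δ)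
      hcrow (by rw [hU0, hM, hu, hs01]) (by rw [hU1, hM, hv, hs10]) (by rw [hU2, hM, hu, hs01])
  rw [hGA, _root_.smul_apply, dicksonRow_of_fixed σ a ha, pencilForm_shift, smul_eq_mul] at hGU
  exact (mul_ne_zero hlead hU) hGU

end

/-! ### Iterates of ψ, their coefficients, and coordinates -/

section

variable {F K : Type*} [Field F] [Field K] [Algebra F K]

theorem autPsi_half_add (h2 : (2 : K) ≠ 0) (τ : K ≃ₐ[F] K) {y z : K} (hy : (τ ^ 4) y = y)
    (hz : (τ ^ 4) z = -z) : autPsi τ (2⁻¹ * (y + z)) = 2⁻¹ * ((τ ^ 3) y + τ z) := by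
  have h24 : (τ ^ 4) 2 = 2 := map_ofNat (τ ^ 4) 2
  have h23 : (τ ^ 3) 2 = 2 := map_ofNat (τ ^ 3) 2
  have h21 : τ 2 = 2 := map_ofNat τ 2
  simp only [autPsi, map_add, map_sub, map_mul, map_inv₀, h24, h23, h21, hy, hz, map_neg]
  field_simp
  ring

/-- The third iterate of `autPsi τ` is `autPsi (τ ^ 3)`. -/
theorem autPsi_iterate_three (h2 : (2 : K) ≠ 0) (τ : K ≃ₐ[F] K) (hτ : τ ^ 8 = 1) (x : K) :
    autPsi τ (autPsi τ (autPsi τ x)) = autPsi (τ ^ 3) x := by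
  have hcomm : ∀ m z, (τ ^ 4) ((τ ^ m) z) = (τ ^ m) ((τ ^ 4) z) := fun m z => by
    rw [← AlgEquiv.mul_apply, ← AlgEquiv.mul_apply, ← pow_add, ← pow_add, add_comm]
  have h8 : ∀ z, (τ ^ 4) ((τ ^ 4) z) = z := fun z => by
    rw [← AlgEquiv.mul_apply, ← pow_add, hτ, AlgEquiv.one_apply]
  -- Each application acts by τ³ on the part fixed by τ⁴ and by τ on the part it negates.
  have hstep : ∀ m n y z, (τ ^ 4) y = y → (τ ^ 4) z = -z →
      autPsi τ (2⁻¹ * ((τ ^ m) y + (τ ^ n) z)) =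
        2⁻¹ * ((τ ^ (3 + m)) y + (τ ^ (1 + n)) z) := by
    intro m n y z hy hz
    rw [autPsi_half_add h2 τ (by rw [hcomm, hy]) (by rw [hcomm, hz, map_neg]), pow_add, pow_add,
      pow_one, AlgEquiv.mul_apply, AlgEquiv.mul_apply]
  have hy : (τ ^ 4) (x + (τ ^ 4) x) = x + (τ ^ 4) x := by rw [map_add, h8, add_comm]
  have hz : (τ ^ 4) (x - (τ ^ 4) x) = -(x - (τ ^ 4) x) := by rw [map_sub, h8, neg_sub]
  have hx : x = 2⁻¹ * ((τ ^ 0) (x + (τ ^ 4) x) + (τ ^ 0) (x - (τ ^ 4) x)) := by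
    simp only [pow_zero, AlgEquiv.one_apply]
    field_simp
    ring
  conv_lhs => rw [hx, hstep _ _ _ _ hy hz, hstep _ _ _ _ hy hz, hstep _ _ _ _ hy hz]
  have h12 : (τ ^ 3) ^ 4 = τ ^ 4 := by rw [← pow_mul, pow_eq_pow_mod _ hτ]
  rw [autPsi, h12, ← pow_mul, add_comm]

/-- Expansion of `autPsi (σ ^ m)` in powers of `σ`, for odd `m`. -/
theorem exists_coeff_autPsi (h2 : (2 : K) ≠ 0) (σ : K ≃ₐ[F] K) (hσ : σ ^ 8 = 1) (m : ℕ)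
    (hm : Odd m) : ∃ a : Fin 8 → K, (∀ j, σ (a j) = a j) ∧ a 0 = 0 ∧ a 2 = 0 ∧ a 4 = 0 ∧ a 6 = 0 ∧
      a 1 * a 7 ≠ 0 ∧ a 3 * a 5 ≠ 0 ∧ a 1 * a 3 - a 5 * a 7 ≠ 0 ∧ a 1 * a 7 - a 3 * a 5 ≠ 0 ∧
      ∀ x, autPsi (σ ^ m) x = ∑ j : Fin 8, a j * (σ ^ (j : ℕ)) x := by
  have h4 : (σ ^ m) ^ 4 = σ ^ 4 := by
    obtain ⟨l, rfl⟩ := hm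
    rw [← pow_mul, pow_eq_pow_mod _ hσ]
    congr 1
    omega
  have hexp : ∀ x, autPsi (σ ^ m) x =
      2⁻¹ * ((σ ^ (m % 8)) x - (σ ^ ((m + 4) % 8)) x +
        ((σ ^ (m * 3 % 8)) x + (σ ^ ((m * 3 + 4) % 8)) x)) := by
    intro x
    simp only [← pow_eq_pow_mod _ hσ]
    rw [autPsi, h4, ← pow_mul, map_sub, map_add, pow_add, pow_add, AlgEquiv.mul_apply,
      AlgEquiv.mul_apply]
  have hhalf : σ 2⁻¹ = 2⁻¹ := by rw [map_inv₀, map_ofNat]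
  have hsq : (2⁻¹ : K) * 2⁻¹ + 2⁻¹ * 2⁻¹ ≠ 0 := by
    rw [← mul_add, show (2⁻¹ + 2⁻¹ : K) = 1 by field_simp; norm_num, mul_one]
    exact inv_ne_zero h2
  have hsq' : -((2⁻¹ : K) * 2⁻¹) - 2⁻¹ * 2⁻¹ ≠ 0 := by
    rw [← neg_add']
    exact neg_ne_zero.mpr hsq
  have hcase : m % 8 = 1 ∨ m % 8 = 3 ∨ m % 8 = 5 ∨ m % 8 = 7 := by
    obtain ⟨l, rfl⟩ := hm
    omega
  -- The coefficients at m, 3m, 3m + 4 are 1/2 and the one at m + 4 is -1/2. With exactly one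
  -- negative sign, a₁a₃ and a₅a₇ are opposite, as are a₁a₇ and a₃a₅.
  rcases hcase with h | h | h | h
  · refine ⟨![0, 2⁻¹, 0, 2⁻¹, 0, -2⁻¹, 0, 2⁻¹], fun j => ?_, rfl, rfl, rfl, rfl, ?_, ?_, ?_, ?_, fun x => ?_⟩
    · fin_cases j <;> simp [hhalf]
    · simpa using h2
    · simpa using h2
    · simpa using hsq
    · simpa using hsq
    · have e₁ : (m + 4) % 8 = 5 := by omega
      have e₂ : m * 3 % 8 = 3 := by omega
      have e₃ : (m * 3 + 4) % 8 = 7 := by omega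
      rw [hexp, h, e₁, e₂, e₃]
      simp [Fin.sum_univ_eight]
      ring
  · refine ⟨![0, 2⁻¹, 0, 2⁻¹, 0, 2⁻¹, 0, -2⁻¹], fun j => ?_, rfl, rfl, rfl, rfl, ?_, ?_, ?_, ?_, fun x => ?_⟩
    · fin_cases j <;> simp [hhalf]
    · simpa using h2
    · simpa using h2
    · simpa using hsq
    · simpa using hsq'
    · have e₁ : (m + 4) % 8 = 7 := by omega
      have e₂ : m * 3 % 8 = 1 := by omega
      have e₃ : (m * 3 + 4) % 8 = 5 := by omega
      rw [hexp, h, e₁, e₂, e₃]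
      simp [Fin.sum_univ_eight]
      ring
  · refine ⟨![0, -2⁻¹, 0, 2⁻¹, 0, 2⁻¹, 0, 2⁻¹], fun j => ?_, rfl, rfl, rfl, rfl, ?_, ?_, ?_, ?_, fun x => ?_⟩
    · fin_cases j <;> simp [hhalf]
    · simpa using h2
    · simpa using h2
    · simpa using hsq'
    · simpa using hsq'
    · have e₁ : (m + 4) % 8 = 1 := by omega
      have e₂ : m * 3 % 8 = 7 := by omega
      have e₃ : (m * 3 + 4) % 8 = 3 := by omega
      rw [hexp, h, e₁, e₂, e₃]
      simp [Fin.sum_univ_eight]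
      ring
  · refine ⟨![0, 2⁻¹, 0, -2⁻¹, 0, 2⁻¹, 0, 2⁻¹], fun j => ?_, rfl, rfl, rfl, rfl, ?_, ?_, ?_, ?_, fun x => ?_⟩
    · fin_cases j <;> simp [hhalf]
    · simpa using h2
    · simpa using h2
    · simpa using hsq'
    · simpa using hsq
    · have e₁ : (m + 4) % 8 = 3 := by omega
      have e₂ : m * 3 % 8 = 5 := by omega
      have e₃ : (m * 3 + 4) % 8 = 1 := by omega
      rw [hexp, h, e₁, e₂, e₃]
      simp [Fin.sum_univ_eight]
      ring

variable (F K) in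
theorem exists_frobenius [Finite F] (hdeg : Module.finrank F K = 8) :
    ∃ φ : K ≃ₐ[F] K, φ ^ 8 = 1 ∧ ∀ (i : ℕ) (x : K), (φ ^ i) x = x ^ Nat.card F ^ i := by
  have := Fintype.ofFinite F
  have : FiniteDimensional F K := FiniteDimensional.of_finrank_pos (by omega)
  have : Finite K := Module.finite_of_finite F
  refine ⟨FiniteField.frobeniusAlgEquivOfAlgebraic F K, ?_, fun i x => ?_⟩
  · rw [← hdeg, ← FiniteField.orderOf_frobeniusAlgEquivOfAlgebraic F K, pow_orderOf_eq_one]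
  · rw [AlgEquiv.coe_pow, FiniteField.coe_frobeniusAlgEquivOfAlgebraic_iterate,
      Nat.card_eq_fintype_card]

theorem psi_apply [Finite F] (φ : K ≃ₐ[F] K)
    (hφ : ∀ (i : ℕ) (x : K), (φ ^ i) x = x ^ Nat.card F ^ i) (x : K) :
    psi F K 4 x = autPsi φ x := by
  have hq : ∀ i y, qPow F K i y = (φ ^ i) y := fun i y => (hφ i y).symm
  simp only [psi, alpha, beta, LinearMap.add_apply, LinearMap.smul_apply, LinearMap.comp_apply,
    LinearMap.sub_apply, LinearMap.id_apply, hq, autPsi, smul_eq_mul, pow_one]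
  ring

theorem psi_pow_apply [Finite F] (h2 : (2 : K) ≠ 0) (φ : K ≃ₐ[F] K) (hφ8 : φ ^ 8 = 1)
    (hφ : ∀ (i : ℕ) (x : K), (φ ^ i) x = x ^ Nat.card F ^ i) (k : ℕ) (hk : k = 1 ∨ k = 3) (x : K) :
    (psi F K 4 ^ k) x = autPsi (φ ^ k) x := by
  rcases hk with rfl | rfl
  · rw [pow_one, pow_one, psi_apply φ hφ]
  · rw [← autPsi_iterate_three h2 φ hφ8, pow_succ, pow_two, Module.End.mul_apply,
      Module.End.mul_apply, psi_apply φ hφ, psi_apply φ hφ, psi_apply φ hφ]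

/-- Membership in the image of a linear set of a graph, in coordinates. -/
theorem exists_proportional_of_image_eq {f g : Module.End F K} {σ : K ≃+* K}
    (A : (K × K) →ₛₗ[(σ : K →+* K)] (K × K)) (hA : Function.Bijective A)
    (h : Projectivization.map A hA.injective '' linearSetOf f = linearSetOf g) {x w : K}
    (hx : x ≠ 0) (hw : f x = w * x) :
    ∃ x', x' ≠ 0 ∧ (A (1, 0) + σ w • A (0, 1)).1 * g x' =
      (A (1, 0) + σ w • A (0, 1)).2 * x' := by
  have hu : ((x, f x) : K × K) ≠ 0 := fun h0 => hx (congrArg Prod.fst h0)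
  have hmem : Projectivization.map A hA.injective (Projectivization.mk K (x, f x) hu) ∈
      linearSetOf g := by
    rw [← h]
    exact ⟨_, ⟨(x, f x), hu, rfl, rfl⟩, rfl⟩
  obtain ⟨v, hv0, hv, hP⟩ := hmem
  rw [Projectivization.map_mk, Projectivization.mk_eq_mk_iff'] at hP
  obtain ⟨t, ht⟩ := hP
  obtain ⟨x', y'⟩ := v
  have hy' : y' = g x' := hv
  subst hy'
  refine ⟨x', ?_, ?_⟩
  · rintro rfl
    exact hv0 (by simp)
  · have hsplit : ((x, f x) : K × K) = x • ((1, 0) : K × K) + (w * x) • ((0, 1) : K × K) := by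
      simp [hw]
    rw [hsplit, map_add, map_smulₛₗ, map_smulₛₗ, RingEquiv.coe_toRingHom, map_mul] at ht
    have hσx : σ x ≠ 0 := by simpa using hx
    have h1 := congrArg Prod.fst ht
    have h2 := congrArg Prod.snd ht
    simp only [Prod.smul_fst, Prod.smul_snd, Prod.fst_add, Prod.snd_add, smul_eq_mul] at h1 h2 ⊢
    apply mul_left_cancel₀ hσx
    linear_combination x' * h2 - g x' * h1

end

end ScatteredLinearSets

/-! ### The main theorem -/

open ScatteredLinearSets

theorem proposition3p5 {F K : Type*} [Field F] [Finite F] [Field K] [Algebra F K]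
    (hodd : Odd (Nat.card F)) (hdeg : Module.finrank F K = 8) (k : ℕ) (hk : k = 1 ∨ k = 3) :
    ¬ ScatteredLinearSets.IsLPType F
        (ScatteredLinearSets.linearSetOf (ScatteredLinearSets.psi F K 4 ^ k)) := by
  classical
  rintro ⟨-, s, δ, hs1, hs8, hgcd, -, -, ρ, A, hA, hAL⟩
  rw [hdeg] at hs8 hgcd hAL
  have hsodd : s % 2 = 1 := by
    interval_cases s <;> simp_all
  have : FiniteDimensional F K := FiniteDimensional.of_finrank_pos (by omega)
  have : Finite K := Module.finite_of_finite F
  have := Fintype.ofFinite K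
  have hq : 2 ≤ Nat.card F := Finite.one_lt_card
  have h2 : (2 : K) ≠ 0 := by
    have hF : (2 : F) ≠ 0 := by
      intro h
      have := Fintype.ofFinite F
      obtain ⟨l, hl⟩ := hodd
      have hc := FiniteField.cast_card_eq_zero F
      rw [← Nat.card_eq_fintype_card, hl, Nat.cast_add, Nat.cast_mul, Nat.cast_ofNat, h, zero_mul,
        zero_add, Nat.cast_one] at hc
      exact one_ne_zero hc
    have h := (map_ne_zero (algebraMap F K)).mpr hF
    rwa [map_ofNat] at h
  obtain ⟨φ, hφ8, hφ⟩ := exists_frobenius F K hdeg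
  have hψ := psi_pow_apply h2 φ hφ8 hφ k hk
  have hτ8 : (φ ^ k) ^ 8 = 1 := by rw [pow_right_comm, hφ8, one_pow]
  have hσ8 : (φ ^ s) ^ 8 = 1 := by rw [pow_right_comm, hφ8, one_pow]
  -- Odd squares are 1 modulo 8, so s is its own inverse; the same holds for k in `hτφ`.
  have hτσ : φ ^ k = (φ ^ s) ^ (k * s) := by
    rw [← pow_mul, pow_eq_pow_mod k hφ8, pow_eq_pow_mod (s * (k * s)) hφ8]
    congr 1
    rcases hk with rfl | rfl <;> interval_cases s <;> simp_all
  have hτφ : (φ ^ k) ^ k = φ := by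
    rcases hk with rfl | rfl
    · simp
    · rw [← pow_mul, pow_eq_pow_mod _ hφ8, pow_one]
  have hσ7 : (φ ^ s) ^ 7 = φ ^ (8 - s) := by
    rw [← pow_mul, pow_eq_pow_mod (s * 7) hφ8, pow_eq_pow_mod (8 - s) hφ8]
    congr 1
    omega
  obtain ⟨a, ha, h0, h2', h4, h6, h17, h35, hne, hne', hsum⟩ := exists_coeff_autPsi h2 (φ ^ s) hσ8
    (k * s) (by rw [Nat.odd_iff]; rcases hk with rfl | rfl <;> omega)
  rw [← hτσ] at hsum
  have hK : Fintype.card K = Nat.card F ^ 8 := by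
    rw [← Nat.card_eq_fintype_card, Module.natCard_eq_pow_finrank (K := F), hdeg]
  have hcard := sum_pow_le_card_slopes hq hK (autPsi (φ ^ k)) (by
    intro m x y hx hy hmx hmy
    have hfix : (φ ^ k) (x / y) = x / y := by
      have h := autPsi_scattered h2 (φ ^ k) hτ8 hx hmx hmy
      rw [map_div₀, div_eq_div_iff ((map_ne_zero_iff _ (φ ^ k).injective).mpr hy) hy, h, mul_comm]
    have hfix' : ∀ n, ((φ ^ k) ^ n) (x / y) = x / y := by
      intro n
      induction n with
      | zero => simp
      | succ n ih => rw [pow_succ, AlgEquiv.mul_apply, hfix, ih]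
    have h := hfix' k
    rwa [hτφ, ← pow_one φ, hφ, pow_one] at h)
  refine false_of_slopes_to_binomial hq (φ ^ s) hσ8 (fun i => s * i % 8) ?_ ?_ a ha h0 h2' h4 h6
    h17 h35 hne hne' _ (le_trans (le_of_eq ?_) hcard) ?_ δ (A (1, 0)) (A (0, 1)) ?_ ?_
  · intro i j hij
    ext
    simp only at hij
    interval_cases s <;> omega
  · intro i x
    rw [← pow_mul, pow_eq_pow_mod _ hφ8, hφ]
  -- Multiplication by the odd number s permutes the residues modulo 8.
  · simp only [Finset.sum_range_succ, Fin.sum_univ_eight]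
    interval_cases s <;> simp_all <;> ring
  · intro w hw
    obtain ⟨x, hx, rfl⟩ := Finset.mem_image.mp hw
    have hx0 := (Finset.mem_erase.mp hx).1
    exact ⟨x, hx0, by rw [← hsum, div_mul_cancel₀ _ hx0]⟩
  · intro v
    obtain ⟨⟨α, β⟩, rfl⟩ := hA.surjective v
    refine ⟨(ρ α, ρ β), ?_⟩
    have : ((α, β) : K × K) = α • ((1, 0) : K × K) + β • ((0, 1) : K × K) := by simp
    conv_rhs => rw [this, map_add, map_smulₛₗ, map_smulₛₗ]
    rfl
  · intro w hw
    obtain ⟨x, hx, rfl⟩ := Finset.mem_image.mp hw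
    have hx0 := (Finset.mem_erase.mp hx).1
    -- The coefficients lie in the prime field, so field automorphisms permute the slopes. Starting
    -- from the slope ρ⁻¹(w) absorbs the twist of the semilinear map.
    have hρ : ∀ y, ρ.symm (autPsi (φ ^ k) y) = autPsi (φ ^ k) (ρ.symm y) := by
      intro y
      simp only [autPsi, ← pow_mul, hφ, map_mul, map_add, map_sub, map_pow, map_inv₀, map_ofNat]
    obtain ⟨x', hx', h⟩ := exists_proportional_of_image_eq A hA hAL (x := ρ.symm x)
      (w := ρ.symm (autPsi (φ ^ k) x / x)) (by simpa using hx0)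
      (by rw [hψ, ← hρ, ← map_mul, div_mul_cancel₀ _ hx0])
    refine ⟨x', hx', ?_⟩
    rw [RingEquiv.apply_symm_apply] at h
    rw [hσ7, hφ, hφ]
    exact h
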